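/- Let $\mathcal H$ be a real separable Hilbert space with inner product $\langle\cdot,\cdot\rangle$ and norm $|\cdot|$, and let $\mathcal N\subset\mathcal H$ be a nuclear space, densely and continuously embedded in $\mathcal H$, which is the projective limit $\mathcal N=\bigcap_{p\ge 0}\mathcal H_p$ of real separable Hilbert spaces $\mathcal H_p$ with $\mathcal H_0=\mathcal H$, $\mathcal H_{p+1}\subset\mathcal H_p$, $|\cdot|_p\le|\cdot|_{p+1}$ on $\mathcal H_{p+1}$, and Hilbert–Schmidt inclusions $\mathcal H_{p+1}\subset\mathcal H_p$. Let $\mathcal N_{\mathbb C}=\{\varphi_1+i\varphi_2:\varphi_1,\varphi_2\in\mathcal N\}$ be the complexification of $\mathcal N$, with $|\varphi_1+i\varphi_2|^2=|\varphi_1|^2+|\varphi_2|^2$, and extend $\langle\cdot,\cdot\rangle$ complex-bilinearly. For $0<\beta\le 1$ let $$\mathrm E_\beta(z)=\sum_{n=0}^\infty\frac{z^n}{\Gamma(\beta n+1)},\qquad z\in\mathbb C,$$ be the Mittag-Leffler function. For $\eta\in\mathcal H$, $\varphi\in\mathcal N_{\mathbb C}$ and $x\in\mathbb R$ let $$z(x,\eta,\varphi)=\tfrac12x^2\langle\eta,\eta\rangle+\tfrac12\langle\varphi,\varphi\rangle+x\langle\eta,\varphi\rangle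 .$$ Then for every $0<\beta\le1$, every $\eta\in\mathcal H$ with $\eta\neq0$ and every $0<M<\infty$ there is a constant $C<\infty$ (which may depend on $\beta$, $\eta$ and $M$, but not on $\varphi$) such that $$\int_{\mathbb R}\bigl|\mathrm E_\beta(-z(x,\eta,\varphi))\bigr|\,dx\le C\qquad\text{for all }\varphi\in\mathcal N_{\mathbb C}\text{ with }|\varphi|<M .$$ -/

import Mathlib

open MeasureTheory

noncomputable section

/-- The Mittag-Leffler function `E_β(z) = ∑ zⁿ / Γ(β n + 1)`. -/
def mittagLeffler (β : ℝ) (z : ℂ) : ℂ :=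
  ∑' n : ℕ, z ^ n / Complex.Gamma ((β : ℂ) * (n : ℂ) + 1)

/-- A bounded operator between real Hilbert spaces is Hilbert-Schmidt if `∑ ‖T eᵢ‖² < ∞` for an
orthonormal (Hilbert) basis `(eᵢ)` of the source. -/
def IsHilbertSchmidtOp {E F : Type*} [NormedAddCommGroup E] [InnerProductSpace ℝ E]
    [CompleteSpace E] [NormedAddCommGroup F] [InnerProductSpace ℝ F] (T : E →L[ℝ] F) : Prop :=
  ∃ (s : Set E) (b : HilbertBasis s ℝ E), Summable fun i : s => ‖T (b i)‖ ^ 2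

/-- The data that make `N ⊂ H` part of a nuclear triple `N ⊂ H ⊂ N'`: real separable Hilbert spaces
`K p` with `K 0 = H` and norm-decreasing Hilbert-Schmidt inclusions `K (p + 1) ⊂ K p`, whose
projective limit is `N`, with `N` dense in `H`. -/
structure NuclearTriple (N H : Type*) (K : ℕ → Type*)
    [AddCommGroup N] [Module ℝ N] [TopologicalSpace N]
    [NormedAddCommGroup H] [InnerProductSpace ℝ H] [CompleteSpace H]
    [TopologicalSpace.SeparableSpace H]
    [∀ p, NormedAddCommGroup (K p)] [∀ p, InnerProductSpace ℝ (K p)] [∀ p, CompleteSpace (K p)]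
    [∀ p, TopologicalSpace.SeparableSpace (K p)] where
  /-- the identification `K 0 = H` -/
  zeroEquiv : K 0 ≃ₗᵢ[ℝ] H
  /-- the inclusion `K (p + 1) ⊂ K p` -/
  incl : ∀ p, K (p + 1) →L[ℝ] K p
  incl_injective : ∀ p, Function.Injective (incl p)
  norm_incl_le : ∀ p f, ‖incl p f‖ ≤ ‖f‖
  incl_hilbertSchmidt : ∀ p, IsHilbertSchmidtOp (incl p)
  /-- the inclusion `N ⊂ K p` -/
  proj : ∀ p, N →ₗ[ℝ] K p
  incl_proj : ∀ p φ, incl p (proj (p + 1) φ) = proj p φ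
  /-- `N` is the intersection of the `K p` -/
  exists_unique_lift : ∀ f : ∀ p, K p, (∀ p, incl p (f (p + 1)) = f p) →
    ∃! φ : N, ∀ p, proj p φ = f p
  /-- the topology of `N` is the coarsest one for which all inclusions `N ⊂ K p` are continuous -/
  topology_eq : (inferInstance : TopologicalSpace N) =
    ⨅ p, TopologicalSpace.induced (proj p) inferInstance
  dense_range : DenseRange fun φ : N => zeroEquiv (proj 0 φ)

namespace NuclearTriple

variable {N H : Type*} {K : ℕ → Type*}
    [AddCommGroup N] [Module ℝ N] [TopologicalSpace N]
    [NormedAddCommGroup H] [InnerProductSpace ℝ H] [CompleteSpace H]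
    [TopologicalSpace.SeparableSpace H]
    [∀ p, NormedAddCommGroup (K p)] [∀ p, InnerProductSpace ℝ (K p)] [∀ p, CompleteSpace (K p)]
    [∀ p, TopologicalSpace.SeparableSpace (K p)]

/-- The inclusion `N ⊂ H`. -/
def toH (T : NuclearTriple N H K) : N →ₗ[ℝ] H :=
  T.zeroEquiv.toLinearEquiv.toLinearMap ∘ₗ T.proj 0

end NuclearTriple

/-- The complexification of a real vector space: pairs `[f₁, f₂]`, thought of as `f₁ + i f₂`. -/
@[ext]
structure Complexified (E : Type*) where
  re : E
  im : E

namespace Complexified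

section Algebra

variable {E F : Type*} [AddCommGroup E] [AddCommGroup F]

instance : Zero (Complexified E) := ⟨⟨0, 0⟩⟩
instance : Add (Complexified E) := ⟨fun f g => ⟨f.re + g.re, f.im + g.im⟩⟩
instance : Neg (Complexified E) := ⟨fun f => ⟨-f.re, -f.im⟩⟩

@[simp] theorem zero_re : (0 : Complexified E).re = 0 := rfl
@[simp] theorem zero_im : (0 : Complexified E).im = 0 := rfl
@[simp] theorem add_re (f g : Complexified E) : (f + g).re = f.re + g.re := rfl
@[simp] theorem add_im (f g : Complexified E) : (f + g).im = f.im + g.im := rfl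
@[simp] theorem neg_re (f : Complexified E) : (-f).re = -f.re := rfl
@[simp] theorem neg_im (f : Complexified E) : (-f).im = -f.im := rfl

variable [Module ℝ E] [Module ℝ F]

instance : SMul ℂ (Complexified E) :=
  ⟨fun c f => ⟨c.re • f.re - c.im • f.im, c.re • f.im + c.im • f.re⟩⟩

@[simp] theorem smul_re (c : ℂ) (f : Complexified E) :
    (c • f).re = c.re • f.re - c.im • f.im := rfl
@[simp] theorem smul_im (c : ℂ) (f : Complexified E) :
    (c • f).im = c.re • f.im + c.im • f.re := rfl

instance : AddCommGroup (Complexified E) where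
  add_assoc f g h := by ext <;> simp [add_assoc]
  zero_add f := by ext <;> simp
  add_zero f := by ext <;> simp
  add_comm f g := by ext <;> simp [add_comm]
  neg_add_cancel f := by ext <;> simp
  nsmul := nsmulRec
  zsmul := zsmulRec

instance : Module ℂ (Complexified E) where
  one_smul f := by ext <;> simp
  mul_smul c d f := by ext <;> simp <;> module
  smul_zero c := by ext <;> simp
  smul_add c f g := by ext <;> simp <;> module
  add_smul c d f := by ext <;> simp <;> module
  zero_smul f := by ext <;> simp

/-- The real vector space `E` as a subset of its complexification. -/
def ofReal (f : E) : Complexified E := ⟨f, 0⟩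

/-- The complex linear extension of a real linear map. -/
def map (L : E →ₗ[ℝ] F) : Complexified E →ₗ[ℂ] Complexified F where
  toFun f := ⟨L f.re, L f.im⟩
  map_add' f g := by ext <;> simp
  map_smul' c f := by ext <;> simp

end Algebra

section Hilbert

variable {H : Type*} [NormedAddCommGroup H] [InnerProductSpace ℝ H]

/-- The complex bilinear (not sesquilinear) extension of the real inner product. -/
def pairing (f g : Complexified H) : ℂ :=
  ((inner ℝ f.re g.re - inner ℝ f.im g.im : ℝ) : ℂ) +
    Complex.I * ((inner ℝ f.re g.im + inner ℝ f.im g.re : ℝ) : ℂ)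

/-- The Hilbert space norm of the complexification, `|f₁ + i f₂|² = |f₁|² + |f₂|²`. -/
def hnorm (f : Complexified H) : ℝ := Real.sqrt (‖f.re‖ ^ 2 + ‖f.im‖ ^ 2)

end Hilbert

end Complexified

/-- `z(x, η, φ) = ½ x² ⟨η, η⟩ + ½ ⟨φ, φ⟩ + x ⟨η, φ⟩`. -/
def donskerArg {H : Type*} [NormedAddCommGroup H] [InnerProductSpace ℝ H]
    (x : ℝ) (η : H) (φ : Complexified H) : ℂ :=
  1 / 2 * (x : ℂ) ^ 2 *
      Complexified.pairing (Complexified.ofReal η) (Complexified.ofReal η) +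
    1 / 2 * Complexified.pairing φ φ +
    (x : ℂ) * Complexified.pairing (Complexified.ofReal η) φ

end

/-!
The function `E_β(-z)` is a limit of coefficients: by Euler's limit formula for the Gamma function,
it is the limit of the `n`-th coefficient of `D = (1 - X) ^ (β - 1) / (ε + (1 - X) ^ β)` at
`ε = z / n ^ β`. For `0 < β ≤ 1` the series `1 - (1 - X) ^ β` and `(1 - X) ^ (β - 1)` have
nonnegative coefficients, so replacing `ε` by its real part majorizes all coefficients of `D`. For
real `ε ≥ 0` these are nonnegative and decreasing, so the Volterra identity
`D + ε * (1 - X) ^ (-β) * D = (1 - X) ^ (-1)` bounds the `n`-th one by `1 / (1 + ε * cₙ)`, where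
`cₙ` is the `n`-th coefficient of `(1 - X) ^ (-β - 1)` and `cₙ ~ n ^ β / Γ(β + 1)`. In the limit
`|E_β(-z)| ≤ 1 / (1 + Re z / Γ(β + 1))` whenever `Re z ≥ 0`.

The argument `z(x, η, φ) = ½ ⟨xη + φ, xη + φ⟩` stays in the parabolic region `|z| ≤ Re z + M²`,
where `E_β(-z)` is therefore `O(1 / (1 + |z|))`; as `|z|` grows like `x²`, this is integrable in
`x`.
-/

open Filter Topology PowerSeries

section Multichoose

theorem multichoose_succ_right {K : Type*} [Field K] [CharZero K] (a : K) (n : ℕ) :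
    Ring.multichoose a (n + 1) = Ring.multichoose a n * ((a + n) / (n + 1)) := by
  have factorial_mul (m : ℕ) : (m.factorial : K) * Ring.multichoose a m =
      (ascPochhammer K m).eval a := by
    rw [← nsmul_eq_mul, Ring.factorial_nsmul_multichoose_eq_ascPochhammer,
      Polynomial.ascPochhammer_smeval_eq_eval]
  have hsucc := factorial_mul (n + 1)
  rw [ascPochhammer_succ_eval, ← factorial_mul n, Nat.factorial_succ] at hsucc
  have hn : (n : K) + 1 ≠ 0 := n.cast_add_one_ne_zero
  refine mul_left_cancel₀ (Nat.cast_ne_zero.2 (n + 1).factorial_ne_zero : _ ≠ (0 : K)) ?_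
  rw [Nat.factorial_succ, hsucc]
  push_cast
  field_simp

variable {K : Type*} [Field K] [LinearOrder K] [IsStrictOrderedRing K]

theorem multichoose_nonneg {a : K} (ha : 0 ≤ a) (n : ℕ) : 0 ≤ Ring.multichoose a n := by
  induction n with
  | zero => simp
  | succ n ih =>
    rw [multichoose_succ_right]
    positivity

theorem multichoose_neg_succ_nonpos {b : K} (hb0 : 0 ≤ b) (hb1 : b ≤ 1) (n : ℕ) :
    Ring.multichoose (-b) (n + 1) ≤ 0 := by
  induction n with
  | zero => simpa using hb0
  | succ n ih =>
    rw [multichoose_succ_right]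
    refine mul_nonpos_of_nonpos_of_nonneg ih (div_nonneg ?_ (by positivity))
    push_cast
    linarith [n.cast_nonneg (α := K)]

theorem multichoose_le_add_one_pow {a : K} (ha : 0 ≤ a) (n : ℕ) :
    Ring.multichoose a n ≤ (a + 1) ^ n := by
  induction n with
  | zero => simp
  | succ n ih =>
    rw [multichoose_succ_right, pow_succ]
    have hfactor : (a + n) / (n + 1) ≤ a + 1 := by
      rw [div_le_iff₀ (by positivity)]
      nlinarith [mul_nonneg ha (n.cast_nonneg (α := K))]
    gcongr

end Multichoose

theorem one_add_div_mul_rpow_le_one {s x : ℝ} (hs : 0 ≤ s) (hx : 0 ≤ x) :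
    (1 + s / (x + 1)) * (x / (x + 1)) ^ s ≤ 1 := by
  have hbase : x / (x + 1) ≤ Real.exp (-(1 / (x + 1))) :=
    calc x / (x + 1) = -(1 / (x + 1)) + 1 := by field_simp; ring
      _ ≤ _ := Real.add_one_le_exp _
  calc (1 + s / (x + 1)) * (x / (x + 1)) ^ s
      ≤ Real.exp (s / (x + 1)) * Real.exp (-(1 / (x + 1))) ^ s := by
        gcongr
        rw [add_comm]
        exact Real.add_one_le_exp _
    _ = 1 := by
        rw [← Real.exp_mul, ← Real.exp_add]
        ring_nf
        exact Real.exp_zero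

theorem antitoneOn_multichoose_div_rpow {a : ℝ} (ha : 1 ≤ a) :
    AntitoneOn (fun n : ℕ => Ring.multichoose a n / (n : ℝ) ^ (a - 1)) (Set.Ici 1) := by
  refine antitoneOn_nat_Ici_of_succ_le fun n hn => ?_
  have hn0 : (0 : ℝ) < n := by exact_mod_cast hn
  have hstep := one_add_div_mul_rpow_le_one (sub_nonneg.2 ha) hn0.le
  have hcoeff := multichoose_nonneg (zero_le_one.trans ha) n
  rw [Real.div_rpow hn0.le (by positivity)] at hstep
  rw [multichoose_succ_right, Nat.cast_add_one]
  calc Ring.multichoose a n * ((a + n) / (n + 1)) / (n + 1 : ℝ) ^ (a - 1)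
      = Ring.multichoose a n / (n : ℝ) ^ (a - 1) *
        ((1 + (a - 1) / (n + 1)) * ((n : ℝ) ^ (a - 1) / (n + 1 : ℝ) ^ (a - 1))) := by
        field_simp
        ring
    _ ≤ Ring.multichoose a n / (n : ℝ) ^ (a - 1) := mul_le_of_le_one_right (by positivity) hstep

theorem tendsto_multichoose_div_rpow {a : ℝ} (ha : ∀ m : ℕ, a ≠ -m) :
    Tendsto (fun n : ℕ => Ring.multichoose a n / (n : ℝ) ^ (a - 1)) atTop
      (𝓝 (Real.Gamma a)⁻¹) := by
  have ha' (m : ℕ) : a + m ≠ 0 := fun h => ha m (eq_neg_of_add_eq_zero_left h)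
  have prod_eq (n : ℕ) : ∏ j ∈ Finset.range (n + 1), (a + j) =
      n.factorial * Ring.multichoose a n * (a + n) := by
    induction n with
    | zero => simp
    | succ n ih =>
      rw [Finset.prod_range_succ, ih, multichoose_succ_right, Nat.factorial_succ]
      push_cast
      field_simp
  have hlim := (tendsto_natCast_div_add_atTop a).div (Real.GammaSeq_tendsto_Gamma a)
    (Real.Gamma_ne_zero ha)
  rw [one_div] at hlim
  refine hlim.congr' ?_
  filter_upwards [eventually_gt_atTop 0] with n hn
  have hn0 : (0 : ℝ) < n := by exact_mod_cast hn
  have hadd : (n : ℝ) + a ≠ 0 := by rw [add_comm]; exact ha' n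
  rw [Pi.div_apply, Real.GammaSeq, prod_eq, Real.rpow_sub_one hn0.ne']
  field_simp [ha' n]
  ring

theorem summable_add_mul_pow_mul_geometric (b c : ℝ) (L : ℕ) {q : ℝ} (hq : ‖q‖ < 1) :
    Summable fun k : ℕ => (b + k * c) ^ L * q ^ k := by
  refine (summable_norm_mul_geometric_of_norm_lt_one' (k := L) hq ?_).of_norm
  have hlinear : (fun k : ℕ => b + k * c) =O[atTop] fun k : ℕ => (k : ℝ) :=
    (Asymptotics.isLittleO_const_left.2
      (.inr (tendsto_norm_atTop_atTop.comp tendsto_natCast_atTop_atTop))).isBigO.add <| by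
        simpa only [mul_comm] using Asymptotics.isBigO_const_mul_self c (fun k : ℕ => (k : ℝ)) atTop
  simpa using hlinear.pow L

theorem tendsto_natCast_rpow_atTop {β : ℝ} (hβ : 0 < β) :
    Tendsto (fun n : ℕ => (n : ℝ) ^ β) atTop atTop :=
  (tendsto_rpow_atTop hβ).comp tendsto_natCast_atTop_atTop

theorem exists_summable_bound_pow_mul_multichoose {β R : ℝ} (hβ : 0 < β) (hR : 0 ≤ R) :
    ∃ u : ℕ → ℝ, Summable u ∧ ∀ᶠ n : ℕ in atTop, ∀ k : ℕ,
      R ^ k * (Ring.multichoose (k * β + 1) n / (n : ℝ) ^ (k * β)) ≤ u k := by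
  obtain ⟨L, hRL, hL⟩ := (((tendsto_natCast_rpow_atTop hβ).eventually_ge_atTop (2 * R)).and
    (eventually_ge_atTop 1)).exists
  have hL0 : (0 : ℝ) < (L : ℝ) ^ β := Real.rpow_pos_of_pos (by exact_mod_cast hL) β
  refine ⟨fun k => (2 + k * β) ^ L * (1 / 2) ^ k,
    summable_add_mul_pow_mul_geometric 2 β L (by norm_num), ?_⟩
  filter_upwards [eventually_ge_atTop L] with n hn k
  have hanti : Ring.multichoose (k * β + 1) n / (n : ℝ) ^ (k * β) ≤
      Ring.multichoose (k * β + 1) L / (L : ℝ) ^ (k * β) := by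
    simpa only [add_sub_cancel_right] using antitoneOn_multichoose_div_rpow
      (le_add_of_nonneg_left (by positivity : 0 ≤ k * β)) hL (hL.trans hn) hn
  have hpow : (L : ℝ) ^ (k * β) = ((L : ℝ) ^ β) ^ k := by
    rw [mul_comm, Real.rpow_mul_natCast (Nat.cast_nonneg L)]
  have hratio : R / (L : ℝ) ^ β ≤ 1 / 2 := by
    rw [div_le_iff₀ hL0]
    linarith
  have hcoeff : Ring.multichoose (k * β + 1) L ≤ (2 + k * β) ^ L := by
    calc _ ≤ (k * β + 1 + 1) ^ L := multichoose_le_add_one_pow (by positivity) L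
      _ = (2 + k * β) ^ L := by ring
  calc R ^ k * (Ring.multichoose (k * β + 1) n / (n : ℝ) ^ (k * β))
      ≤ R ^ k * (Ring.multichoose (k * β + 1) L / (L : ℝ) ^ (k * β)) := by gcongr
    _ = Ring.multichoose (k * β + 1) L * (R / (L : ℝ) ^ β) ^ k := by rw [hpow, div_pow]; ring
    _ ≤ (2 + k * β) ^ L * (1 / 2) ^ k :=
      mul_le_mul hcoeff (pow_le_pow_left₀ (by positivity) hratio k) (by positivity)
        (by positivity)

theorem tendsto_multichoose_mul_add_one_div_rpow {β : ℝ} (hβ : 0 ≤ β) (k : ℕ) :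
    Tendsto (fun n : ℕ => Ring.multichoose (k * β + 1) n / (n : ℝ) ^ (k * β)) atTop
      (𝓝 (Real.Gamma (k * β + 1))⁻¹) := by
  have hpos : 0 < k * β + 1 := by positivity
  have hne (m : ℕ) : k * β + 1 ≠ -m := ((neg_nonpos.2 m.cast_nonneg).trans_lt hpos).ne'
  simpa only [add_sub_cancel_right] using tendsto_multichoose_div_rpow hne

theorem mittagLeffler_eq_tsum_ofReal (β : ℝ) (z : ℂ) :
    mittagLeffler β z = ∑' k : ℕ, z ^ k * (((Real.Gamma (k * β + 1))⁻¹ : ℝ) : ℂ) := by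
  refine tsum_congr fun k => ?_
  rw [div_eq_mul_inv, Complex.ofReal_inv, ← Complex.Gamma_ofReal]
  push_cast
  rw [mul_comm (β : ℂ)]

theorem exists_summable_bound_pow_div_Gamma {β R : ℝ} (hβ : 0 < β) (hR : 0 ≤ R) :
    ∃ u : ℕ → ℝ, Summable u ∧ ∀ k : ℕ, R ^ k * (Real.Gamma (k * β + 1))⁻¹ ≤ u k := by
  obtain ⟨u, hu, hle⟩ := exists_summable_bound_pow_mul_multichoose hβ hR
  exact ⟨u, hu, fun k => le_of_tendsto
    ((tendsto_multichoose_mul_add_one_div_rpow hβ.le k).const_mul _) (hle.mono fun n hn => hn k)⟩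

theorem continuous_mittagLeffler {β : ℝ} (hβ : 0 < β) : Continuous (mittagLeffler β) := by
  refine continuous_iff_continuousAt.2 fun z => ?_
  obtain ⟨u, hu, hle⟩ := exists_summable_bound_pow_div_Gamma hβ (by positivity : 0 ≤ ‖z‖ + 1)
  suffices h : ContinuousOn (mittagLeffler β) (Metric.ball 0 (‖z‖ + 1)) from
    h.continuousAt (Metric.isOpen_ball.mem_nhds (by simp))
  refine ContinuousOn.congr (continuousOn_tsum (fun k => by fun_prop) hu fun k w hw => ?_)
    fun w _ => mittagLeffler_eq_tsum_ofReal β w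
  have hGamma : 0 < Real.Gamma (k * β + 1) := Real.Gamma_pos_of_pos (by positivity)
  rw [norm_mul, norm_pow, Complex.norm_of_nonneg (inv_nonneg.2 hGamma.le)]
  refine le_trans ?_ (hle k)
  gcongr
  exact (mem_ball_zero_iff.1 hw).le

/-- The binomial power series `(1 - X) ^ a` of a real exponent `a`. -/
noncomputable def oneSubXRpow (A : Type*) [CommRing A] [Algebra ℝ A] (a : ℝ) : A⟦X⟧ :=
  rescale (-1) (binomialSeries A a)

section OneSubXRpow

variable {A : Type*} [CommRing A] [Algebra ℝ A]

theorem coeff_oneSubXRpow (a : ℝ) (n : ℕ) :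
    coeff n (oneSubXRpow A a) = algebraMap ℝ A (Ring.multichoose (-a) n) := by
  have h := Ring.choose_neg (-a) n
  rw [neg_neg, ← Ring.multichoose_eq] at h
  rw [oneSubXRpow, coeff_rescale, binomialSeries_coeff, h, Algebra.algebraMap_eq_smul_one]
  rcases n.even_or_odd with hn | hn <;> simp [Int.negOnePow_even, Int.negOnePow_odd, hn]

theorem constantCoeff_oneSubXRpow (a : ℝ) : constantCoeff (oneSubXRpow A a) = 1 := by
  rw [← coeff_zero_eq_constantCoeff_apply, coeff_oneSubXRpow, Ring.multichoose_zero_right, map_one]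

theorem oneSubXRpow_add (a b : ℝ) :
    oneSubXRpow A (a + b) = oneSubXRpow A a * oneSubXRpow A b := by
  rw [oneSubXRpow, binomialSeries_add, map_mul, oneSubXRpow, oneSubXRpow]

theorem oneSubXRpow_zero : oneSubXRpow A 0 = 1 := by
  rw [oneSubXRpow, binomialSeries_zero, map_one]

theorem oneSubXRpow_one : oneSubXRpow A 1 = 1 - X := by
  have h := binomialSeries_nat (R := ℝ) (A := A) 1
  rw [Nat.cast_one, pow_one] at h
  rw [oneSubXRpow, h, map_add, map_one, rescale_X]
  simp [sub_eq_add_neg]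

theorem oneSubXRpow_natCast_mul (k : ℕ) (a : ℝ) :
    oneSubXRpow A (k * a) = oneSubXRpow A a ^ k := by
  induction k with
  | zero => rw [Nat.cast_zero, zero_mul, oneSubXRpow_zero, pow_zero]
  | succ k ih => rw [Nat.cast_succ, add_one_mul, oneSubXRpow_add, ih, pow_succ]

theorem coeff_oneSubXRpow_neg_one (n : ℕ) : coeff n (oneSubXRpow A (-1)) = 1 := by
  rw [coeff_oneSubXRpow, neg_neg, Ring.multichoose_one, map_one]

end OneSubXRpow

/-- Cauchy's relation between a power series and a real majorant: the coefficients of `P` bound the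
norms of the coefficients of `F`. -/
def IsMajorizedBy {𝕜 : Type*} [NormedField 𝕜] (F : 𝕜⟦X⟧) (P : ℝ⟦X⟧) : Prop :=
  ∀ n, ‖coeff n F‖ ≤ coeff n P

namespace IsMajorizedBy

variable {𝕜 : Type*} [NormedField 𝕜] {F G : 𝕜⟦X⟧} {P Q : ℝ⟦X⟧}

theorem coeff_nonneg (h : IsMajorizedBy F P) (n : ℕ) : 0 ≤ coeff n P :=
  (norm_nonneg _).trans (h n)

theorem mul (hF : IsMajorizedBy F P) (hG : IsMajorizedBy G Q) :
    IsMajorizedBy (F * G) (P * Q) := fun n => by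
  rw [coeff_mul, coeff_mul]
  refine (norm_sum_le _ _).trans (Finset.sum_le_sum fun p _ => ?_)
  rw [norm_mul]
  exact mul_le_mul (hF p.1) (hG p.2) (norm_nonneg _) (hF.coeff_nonneg p.1)

theorem inv (hpos : 0 < constantCoeff P) (hconst : constantCoeff P ≤ ‖constantCoeff F‖)
    (hsucc : ∀ n, ‖coeff (n + 1) F‖ ≤ -coeff (n + 1) P) : IsMajorizedBy F⁻¹ P⁻¹ := fun n => by
  have hinv : ‖(constantCoeff F)⁻¹‖ ≤ (constantCoeff P)⁻¹ := by
    rw [norm_inv]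
    exact inv_anti₀ hpos hconst
  induction n using Nat.strong_induction_on with
  | _ n ih =>
    rw [coeff_inv, coeff_inv]
    rcases n with _ | n
    · simpa only [if_pos] using hinv
    rw [if_neg n.succ_ne_zero, if_neg n.succ_ne_zero, norm_mul, norm_neg, neg_mul_comm,
      ← Finset.sum_neg_distrib]
    refine mul_le_mul hinv ((norm_sum_le _ _).trans (Finset.sum_le_sum fun p hp => ?_))
      (norm_nonneg _) (inv_nonneg.2 hpos.le)
    split_ifs with hlt
    · obtain ⟨m, hm⟩ : ∃ m, p.1 = m + 1 := Nat.exists_eq_succ_of_ne_zero fun h => by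
        have hsum := Finset.HasAntidiagonal.mem_antidiagonal.1 hp
        omega
      rw [norm_mul, ← neg_mul, hm]
      exact mul_le_mul (hsucc m) (ih _ hlt) (norm_nonneg _) ((norm_nonneg _).trans (hsucc m))
    · simp

end IsMajorizedBy

/-- The power series whose `n`-th coefficient is the discrete-time Mittag-Leffler function at time
`n`: the generating function of the discretisation with step one of the fractional relaxation
equation of order `β` with rate `ε`, solved in continuous time by `t ↦ mittagLeffler β (-ε tᵝ)`. -/
noncomputable def discreteMittagLefflerSeries (A : Type*) [Field A] [Algebra ℝ A] (β : ℝ) (ε : A) :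
    A⟦X⟧ :=
  oneSubXRpow A (β - 1) * (C ε + oneSubXRpow A β)⁻¹

section DiscreteMittagLeffler

section Field

variable {A : Type*} [Field A] [Algebra ℝ A]

theorem constantCoeff_C_add_oneSubXRpow (ε : A) (β : ℝ) :
    constantCoeff (C ε + oneSubXRpow A β) = ε + 1 := by
  rw [map_add, constantCoeff_C, constantCoeff_oneSubXRpow]

theorem discreteMittagLefflerSeries_mul_one_add {ε : A} (hε : ε + 1 ≠ 0) (β : ℝ) :
    discreteMittagLefflerSeries A β ε * (1 + C ε * oneSubXRpow A (-β)) = oneSubXRpow A (-1) := by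
  have hconst : constantCoeff (C ε + oneSubXRpow A β) ≠ 0 := by
    rwa [constantCoeff_C_add_oneSubXRpow]
  have hone : 1 = oneSubXRpow A β * oneSubXRpow A (-β) := by
    rw [← oneSubXRpow_add, add_neg_cancel, oneSubXRpow_zero]
  have hfactor : 1 + C ε * oneSubXRpow A (-β) = (C ε + oneSubXRpow A β) * oneSubXRpow A (-β) := by
    rw [add_mul, ← hone, add_comm]
  rw [discreteMittagLefflerSeries, hfactor, mul_assoc, ← mul_assoc _⁻¹,
    PowerSeries.inv_mul_cancel _ hconst, one_mul, ← oneSubXRpow_add]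
  ring_nf

theorem one_sub_X_mul_discreteMittagLefflerSeries {ε : A} (hε : ε + 1 ≠ 0) (β : ℝ) :
    (1 - X) * discreteMittagLefflerSeries A β ε = 1 - C ε * (C ε + oneSubXRpow A β)⁻¹ := by
  have hconst : constantCoeff (C ε + oneSubXRpow A β) ≠ 0 := by
    rwa [constantCoeff_C_add_oneSubXRpow]
  rw [discreteMittagLefflerSeries, ← oneSubXRpow_one, ← mul_assoc, ← oneSubXRpow_add,
    add_sub_cancel, eq_sub_iff_add_eq, ← add_mul, add_comm, PowerSeries.mul_inv_cancel _ hconst]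

end Field

theorem isMajorizedBy_inv_C_add_oneSubXRpow {𝕜 : Type*} [RCLike 𝕜] {β : ℝ} (hβ0 : 0 ≤ β)
    (hβ1 : β ≤ 1) {ε : 𝕜} (hε : -1 < RCLike.re ε) :
    IsMajorizedBy (C ε + oneSubXRpow 𝕜 β)⁻¹ (C (RCLike.re ε) + oneSubXRpow ℝ β)⁻¹ := by
  refine .inv ?_ ?_ fun n => ?_
  · rw [constantCoeff_C_add_oneSubXRpow]
    linarith
  · rw [constantCoeff_C_add_oneSubXRpow, constantCoeff_C_add_oneSubXRpow]
    simpa using RCLike.re_le_norm (ε + 1)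
  · simp only [map_add, coeff_succ_C, zero_add, coeff_oneSubXRpow, norm_algebraMap',
      Algebra.algebraMap_self_apply]
    exact (abs_of_nonpos (multichoose_neg_succ_nonpos hβ0 hβ1 n)).le

theorem isMajorizedBy_discreteMittagLefflerSeries {𝕜 : Type*} [RCLike 𝕜] {β : ℝ} (hβ0 : 0 ≤ β)
    (hβ1 : β ≤ 1) {ε : 𝕜} (hε : -1 < RCLike.re ε) :
    IsMajorizedBy (discreteMittagLefflerSeries 𝕜 β ε)
      (discreteMittagLefflerSeries ℝ β (RCLike.re ε)) := by
  refine .mul (fun n => ?_) (isMajorizedBy_inv_C_add_oneSubXRpow hβ0 hβ1 hε)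
  rw [coeff_oneSubXRpow, coeff_oneSubXRpow, norm_algebraMap', Algebra.algebraMap_self_apply]
  exact (abs_of_nonneg (multichoose_nonneg (by linarith) n)).le

theorem antitone_coeff_discreteMittagLefflerSeries {β t : ℝ} (hβ0 : 0 ≤ β) (hβ1 : β ≤ 1)
    (ht : 0 ≤ t) : Antitone fun n => coeff n (discreteMittagLefflerSeries ℝ β t) := by
  refine antitone_nat_of_succ_le fun n => ?_
  have hcoeff := congrArg (coeff (n + 1))
    (one_sub_X_mul_discreteMittagLefflerSeries (by positivity : t + 1 ≠ 0) β)
  rw [sub_mul, one_mul, map_sub, coeff_succ_X_mul, map_sub, coeff_one, if_neg n.succ_ne_zero,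
    coeff_C_mul] at hcoeff
  have hinv : 0 ≤ coeff (n + 1) (C t + oneSubXRpow ℝ β)⁻¹ :=
    (isMajorizedBy_inv_C_add_oneSubXRpow (𝕜 := ℝ) (ε := t) hβ0 hβ1
      (neg_one_lt_zero.trans_le ht)).coeff_nonneg _
  linarith [mul_nonneg ht hinv]

theorem coeff_discreteMittagLefflerSeries_le {β t : ℝ} (hβ0 : 0 ≤ β) (hβ1 : β ≤ 1) (ht : 0 ≤ t)
    (n : ℕ) : coeff n (discreteMittagLefflerSeries ℝ β t) ≤
      (1 + t * Ring.multichoose (β + 1) n)⁻¹ := by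
  set D := discreteMittagLefflerSeries ℝ β t with hD
  have hanti := antitone_coeff_discreteMittagLefflerSeries hβ0 hβ1 ht
  have hbinomial : coeff n (oneSubXRpow ℝ (-1) * oneSubXRpow ℝ (-β)) =
      Ring.multichoose (β + 1) n := by
    rw [← oneSubXRpow_add, coeff_oneSubXRpow, ← neg_add, neg_neg, add_comm,
      Algebra.algebraMap_self_apply]
  have hconv : coeff n D * Ring.multichoose (β + 1) n ≤ coeff n (D * oneSubXRpow ℝ (-β)) := by
    rw [← hbinomial, coeff_mul, coeff_mul, Finset.mul_sum]
    refine Finset.sum_le_sum fun p hp => ?_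
    rw [coeff_oneSubXRpow_neg_one, one_mul, coeff_oneSubXRpow, neg_neg,
      Algebra.algebraMap_self_apply]
    exact mul_le_mul_of_nonneg_right (hanti (Finset.HasAntidiagonal.antidiagonal.fst_le hp))
      (multichoose_nonneg hβ0 _)
  have hvolterra := congrArg (coeff n)
    (discreteMittagLefflerSeries_mul_one_add (by positivity : t + 1 ≠ 0) β)
  rw [mul_add, mul_one, mul_left_comm, map_add, coeff_C_mul, coeff_oneSubXRpow_neg_one, ← hD]
    at hvolterra
  have hcoeff := multichoose_nonneg (by positivity : 0 ≤ β + 1) n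
  rw [← one_div, le_div_iff₀ (by positivity)]
  linarith [mul_le_mul_of_nonneg_left hconv ht]

open scoped PowerSeries.WithPiTopology in
theorem hasSum_coeff_discreteMittagLefflerSeries {𝕜 : Type*} [RCLike 𝕜] {β : ℝ} (hβ : 0 ≤ β)
    {ε : 𝕜} (hε : ‖ε‖ < 1) (n : ℕ) :
    HasSum (fun k : ℕ => (-ε) ^ k * algebraMap ℝ 𝕜 (Ring.multichoose (k * β + 1) n))
      (coeff n (discreteMittagLefflerSeries 𝕜 β ε)) := by
  have hε1 : ε + 1 ≠ 0 := fun h => by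
    rw [eq_neg_of_add_eq_zero_left h, norm_neg, norm_one] at hε
    exact hε.false
  set Q : 𝕜⟦X⟧ := C (-ε) * oneSubXRpow 𝕜 (-β) with hQ
  have hpow (k : ℕ) : Q ^ k = C ((-ε) ^ k) * oneSubXRpow 𝕜 (k * -β) := by
    rw [hQ, mul_pow, ← oneSubXRpow_natCast_mul, map_pow]
  have hsummable : Summable (Q ^ ·) := by
    refine (PowerSeries.WithPiTopology.summable_iff_summable_coeff 𝕜).2 fun m =>
      .of_norm_bounded (summable_add_mul_pow_mul_geometric 1 β m
        (by rwa [norm_norm] : ‖‖ε‖‖ < 1)) fun k => ?_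
    have hcoeff := multichoose_nonneg (by positivity : 0 ≤ k * β) m
    rw [hpow, coeff_C_mul, coeff_oneSubXRpow, mul_neg, neg_neg, norm_mul, norm_pow, norm_neg,
      norm_algebraMap', Real.norm_of_nonneg hcoeff, mul_comm, add_comm 1]
    gcongr
    exact multichoose_le_add_one_pow (by positivity) m
  have hseries : discreteMittagLefflerSeries 𝕜 β ε = oneSubXRpow 𝕜 (-1) * ∑' k, Q ^ k := by
    have hvolterra : discreteMittagLefflerSeries 𝕜 β ε * (1 - Q) = oneSubXRpow 𝕜 (-1) := by
      rw [hQ, map_neg, neg_mul, sub_neg_eq_add, discreteMittagLefflerSeries_mul_one_add hε1]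
    rw [← hvolterra, mul_assoc, hsummable.one_sub_mul_tsum_pow, mul_one]
  have hsum := (PowerSeries.WithPiTopology.hasSum_iff_hasSum_coeff 𝕜).1
    (hsummable.hasSum.mul_left (oneSubXRpow 𝕜 (-1))) n
  rw [← hseries] at hsum
  convert hsum using 2 with k
  rw [hpow, mul_left_comm, ← oneSubXRpow_add, coeff_C_mul, coeff_oneSubXRpow]
  ring_nf

end DiscreteMittagLeffler

theorem tendsto_coeff_discreteMittagLefflerSeries {β : ℝ} (hβ : 0 < β) (z : ℂ) :
    Tendsto (fun n : ℕ => coeff n (discreteMittagLefflerSeries ℂ β (z / ((n : ℝ) ^ β : ℝ)))) atTop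
      (𝓝 (mittagLeffler β (-z))) := by
  obtain ⟨u, hu, hle⟩ := exists_summable_bound_pow_mul_multichoose hβ (norm_nonneg z)
  have hlim : Tendsto (fun n : ℕ => ∑' k : ℕ,
      (-z) ^ k * ((Ring.multichoose (k * β + 1) n / (n : ℝ) ^ (k * β) : ℝ) : ℂ)) atTop
      (𝓝 (mittagLeffler β (-z))) := by
    rw [mittagLeffler_eq_tsum_ofReal]
    refine tendsto_tsum_of_dominated_convergence hu (fun k => ?_) ?_
    · exact ((Complex.continuous_ofReal.tendsto _).comp
        (tendsto_multichoose_mul_add_one_div_rpow hβ.le k)).const_mul _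
    · filter_upwards [hle] with n hn k
      have hcoeff := multichoose_nonneg (by positivity : 0 ≤ k * β + 1) n
      rw [norm_mul, norm_pow, norm_neg, Complex.norm_of_nonneg (by positivity)]
      exact hn k
  refine hlim.congr' ?_
  filter_upwards [(tendsto_natCast_rpow_atTop hβ).eventually_gt_atTop ‖z‖] with n hn
  have hn0 : 0 < (n : ℝ) ^ β := (norm_nonneg z).trans_lt hn
  have hsmall : ‖z / ((n : ℝ) ^ β : ℝ)‖ < 1 := by
    rwa [norm_div, Complex.norm_of_nonneg hn0.le, div_lt_one hn0]
  rw [← (hasSum_coeff_discreteMittagLefflerSeries hβ.le hsmall n).tsum_eq]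
  refine tsum_congr fun k => ?_
  rw [mul_comm (k : ℝ) β, Real.rpow_mul_natCast n.cast_nonneg, Complex.coe_algebraMap,
    Complex.ofReal_div, Complex.ofReal_pow, ← neg_div, div_pow]
  ring

theorem norm_mittagLeffler_neg_le {β : ℝ} (hβ0 : 0 < β) (hβ1 : β ≤ 1) {z : ℂ} (hz : 0 ≤ z.re) :
    ‖mittagLeffler β (-z)‖ ≤ (1 + z.re * (Real.Gamma (β + 1))⁻¹)⁻¹ := by
  have hGamma : Tendsto (fun n : ℕ => z.re / (n : ℝ) ^ β * Ring.multichoose (β + 1) n) atTop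
      (𝓝 (z.re * (Real.Gamma (β + 1))⁻¹)) := by
    have h := (tendsto_multichoose_mul_add_one_div_rpow hβ0.le 1).const_mul z.re
    simp only [Nat.cast_one, one_mul] at h
    exact h.congr fun n => by ring
  refine le_of_tendsto_of_tendsto' (tendsto_coeff_discreteMittagLefflerSeries hβ0 z).norm
    ((hGamma.const_add 1).inv₀ (by positivity)) fun n => ?_
  have hre : RCLike.re (z / ((n : ℝ) ^ β : ℝ)) = z.re / (n : ℝ) ^ β := Complex.div_ofReal_re z _
  have hnonneg : 0 ≤ z.re / (n : ℝ) ^ β := by positivity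
  calc ‖coeff n (discreteMittagLefflerSeries ℂ β (z / ((n : ℝ) ^ β : ℝ)))‖
      ≤ coeff n (discreteMittagLefflerSeries ℝ β (z.re / (n : ℝ) ^ β)) := by
        rw [← hre]
        exact isMajorizedBy_discreteMittagLefflerSeries hβ0.le hβ1 (by rw [hre]; linarith) n
    _ ≤ _ := coeff_discreteMittagLefflerSeries_le hβ0.le hβ1 hnonneg n

theorem exists_one_add_norm_mul_norm_mittagLeffler_neg_le {β : ℝ} (hβ0 : 0 < β) (hβ1 : β ≤ 1)
    (c : ℝ) : ∃ A, ∀ z : ℂ, ‖z‖ ≤ z.re + c → (1 + ‖z‖) * ‖mittagLeffler β (-z)‖ ≤ A := by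
  obtain ⟨B, hB⟩ := (isCompact_closedBall (0 : ℂ) c).exists_bound_of_continuousOn
    (continuous_mittagLeffler hβ0).continuousOn
  have hGamma : 0 < Real.Gamma (β + 1) := Real.Gamma_pos_of_pos (by positivity)
  refine ⟨max ((1 + c) * B) (1 + c + Real.Gamma (β + 1)), fun z hz => ?_⟩
  rcases le_total z.re 0 with hre | hre
  · have hzc : ‖z‖ ≤ c := by linarith
    refine le_max_of_le_left (mul_le_mul (by gcongr) (hB _ ?_) (norm_nonneg _) ?_)
    · rwa [mem_closedBall_zero_iff, norm_neg]
    · linarith [norm_nonneg z]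
  · have hc : 0 ≤ c := by linarith [Complex.re_le_norm z]
    refine le_max_of_le_right ?_
    calc (1 + ‖z‖) * ‖mittagLeffler β (-z)‖
        ≤ (1 + c + z.re) * (1 + z.re * (Real.Gamma (β + 1))⁻¹)⁻¹ :=
          mul_le_mul (by linarith) (norm_mittagLeffler_neg_le hβ0 hβ1 hre) (norm_nonneg _)
            (by positivity)
      _ ≤ 1 + c + Real.Gamma (β + 1) := by
          rw [← div_eq_mul_inv, div_le_iff₀ (by positivity)]
          have hcancel : Real.Gamma (β + 1) * (z.re * (Real.Gamma (β + 1))⁻¹) = z.re := by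
            field_simp
          have hextra : 0 ≤ (1 + c) * (z.re * (Real.Gamma (β + 1))⁻¹) := by positivity
          linarith

section Donsker

variable {H : Type*} [NormedAddCommGroup H] [InnerProductSpace ℝ H]

namespace Complexified

theorem pairing_self (f : Complexified H) :
    pairing f f = ⟨‖f.re‖ ^ 2 - ‖f.im‖ ^ 2, 2 * inner ℝ f.re f.im⟩ := by
  rw [pairing, mul_comm Complex.I, ← Complex.mk_eq_add_mul_I, real_inner_self_eq_norm_sq,
    real_inner_self_eq_norm_sq, real_inner_comm f.re, two_mul]

theorem norm_pairing_self_le (f : Complexified H) : ‖pairing f f‖ ≤ ‖f.re‖ ^ 2 + ‖f.im‖ ^ 2 := by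
  have hinner : (inner ℝ f.re f.im : ℝ) ^ 2 ≤ ‖f.re‖ ^ 2 * ‖f.im‖ ^ 2 := by
    rw [← mul_pow, ← sq_abs]
    gcongr
    exact abs_real_inner_le_norm _ _
  refine le_of_sq_le_sq ?_ (by positivity)
  rw [pairing_self, Complex.sq_norm, Complex.normSq_mk]
  linarith

end Complexified

theorem donskerArg_eq_half_pairing (x : ℝ) (η : H) (f : Complexified H) :
    donskerArg x η f =
      (1 / 2 : ℝ) * Complexified.pairing ⟨x • η + f.re, f.im⟩ ⟨x • η + f.re, f.im⟩ := by
  simp only [donskerArg, Complexified.pairing, Complexified.ofReal, inner_add_left,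
    inner_add_right, inner_zero_left, inner_zero_right, real_inner_smul_left,
    real_inner_smul_right, real_inner_comm η]
  push_cast
  ring

theorem donskerArg_re (x : ℝ) (η : H) (f : Complexified H) :
    (donskerArg x η f).re = 1 / 2 * (‖x • η + f.re‖ ^ 2 - ‖f.im‖ ^ 2) := by
  rw [donskerArg_eq_half_pairing, Complex.re_ofReal_mul, Complexified.pairing_self]

theorem norm_donskerArg_le (x : ℝ) (η : H) (f : Complexified H) :
    ‖donskerArg x η f‖ ≤ (donskerArg x η f).re + ‖f.im‖ ^ 2 := by
  rw [donskerArg_re, donskerArg_eq_half_pairing, norm_mul, Complex.norm_of_nonneg (by norm_num)]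
  linarith [Complexified.norm_pairing_self_le ⟨x • η + f.re, f.im⟩]

theorem continuous_donskerArg (η : H) (f : Complexified H) :
    Continuous fun x : ℝ => donskerArg x η f := by
  unfold donskerArg
  fun_prop

theorem one_add_sq_le_mul_one_add_norm_donskerArg {M : ℝ} (η : H) {f : Complexified H}
    (hf : ‖f.re‖ ^ 2 + ‖f.im‖ ^ 2 ≤ M ^ 2) (x : ℝ) :
    1 + (‖η‖ * x) ^ 2 ≤ (4 + 2 * M ^ 2) * (1 + ‖donskerArg x η f‖) := by
  have htriangle : ‖x • η‖ ≤ ‖x • η + f.re‖ + ‖f.re‖ := by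
    simpa using norm_sub_le (x • η + f.re) f.re
  have hsq : ‖x • η‖ ^ 2 ≤ 2 * ‖x • η + f.re‖ ^ 2 + 2 * ‖f.re‖ ^ 2 := by
    nlinarith [norm_nonneg (x • η), sq_nonneg (‖x • η + f.re‖ - ‖f.re‖)]
  have hnorm : (‖η‖ * x) ^ 2 = ‖x • η‖ ^ 2 := by
    rw [norm_smul, mul_pow, mul_pow, Real.norm_eq_abs, sq_abs, mul_comm]
  have hre := donskerArg_re x η f
  have hre_le := Complex.re_le_norm (donskerArg x η f)
  rw [hnorm]
  have hcross : 0 ≤ 2 * M ^ 2 * ‖donskerArg x η f‖ := by positivity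
  linarith

theorem exists_norm_mittagLeffler_neg_donskerArg_le {β : ℝ} (hβ0 : 0 < β) (hβ1 : β ≤ 1)
    (M : ℝ) : ∃ A, ∀ (η : H) (f : Complexified H), f.hnorm ≤ M → ∀ x : ℝ,
      ‖mittagLeffler β (-donskerArg x η f)‖ ≤ A * (1 + (‖η‖ * x) ^ 2)⁻¹ := by
  obtain ⟨A, hA⟩ := exists_one_add_norm_mul_norm_mittagLeffler_neg_le hβ0 hβ1 (M ^ 2)
  refine ⟨(4 + 2 * M ^ 2) * A, fun η f hf x => ?_⟩
  have hsq : ‖f.re‖ ^ 2 + ‖f.im‖ ^ 2 ≤ M ^ 2 :=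
    (Real.sqrt_le_left ((Real.sqrt_nonneg _).trans hf)).1 hf
  have hparabola : ‖donskerArg x η f‖ ≤ (donskerArg x η f).re + M ^ 2 := by
    linarith [norm_donskerArg_le x η f, sq_nonneg ‖f.re‖]
  rw [← div_eq_mul_inv, le_div_iff₀ (by positivity)]
  calc ‖mittagLeffler β (-donskerArg x η f)‖ * (1 + (‖η‖ * x) ^ 2)
      ≤ ‖mittagLeffler β (-donskerArg x η f)‖ *
        ((4 + 2 * M ^ 2) * (1 + ‖donskerArg x η f‖)) := by
        gcongr
        exact one_add_sq_le_mul_one_add_norm_donskerArg η hsq x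
    _ = (4 + 2 * M ^ 2) *
        ((1 + ‖donskerArg x η f‖) * ‖mittagLeffler β (-donskerArg x η f)‖) := by ring
    _ ≤ (4 + 2 * M ^ 2) * A := by
        gcongr
        exact hA _ hparabola

end Donsker

theorem mainTheorem11_general {H : Type*} [NormedAddCommGroup H] [InnerProductSpace ℝ H]
    {β : ℝ} (hβ0 : 0 < β) (hβ1 : β ≤ 1) {η : H} (hη : η ≠ 0) (M : ℝ) :
    ∃ C : ℝ, ∀ f : Complexified H, f.hnorm ≤ M →
      Integrable (fun x : ℝ => ‖mittagLeffler β (-donskerArg x η f)‖) ∧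
      ∫ x : ℝ, ‖mittagLeffler β (-donskerArg x η f)‖ ≤ C := by
  obtain ⟨A, hA⟩ := exists_norm_mittagLeffler_neg_donskerArg_le (H := H) hβ0 hβ1 M
  have hbound : Integrable fun x : ℝ => A * (1 + (‖η‖ * x) ^ 2)⁻¹ :=
    (integrable_inv_one_add_sq.comp_mul_left' (norm_ne_zero_iff.2 hη)).const_mul A
  refine ⟨∫ x : ℝ, A * (1 + (‖η‖ * x) ^ 2)⁻¹, fun f hf => ?_⟩
  have hcont : Continuous fun x : ℝ => ‖mittagLeffler β (-donskerArg x η f)‖ :=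
    ((continuous_mittagLeffler hβ0).comp (continuous_donskerArg η f).neg).norm
  have hint : Integrable fun x : ℝ => ‖mittagLeffler β (-donskerArg x η f)‖ :=
    hbound.mono' hcont.aestronglyMeasurable (.of_forall fun x => by
      rw [norm_norm]
      exact hA η f hf x)
  exact ⟨hint, integral_mono hint hbound (hA η f hf)⟩

theorem mainTheorem11 {N H : Type*} {K : ℕ → Type*}
    [AddCommGroup N] [Module ℝ N] [TopologicalSpace N]
    [NormedAddCommGroup H] [InnerProductSpace ℝ H] [CompleteSpace H]
    [TopologicalSpace.SeparableSpace H]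
    [∀ p, NormedAddCommGroup (K p)] [∀ p, InnerProductSpace ℝ (K p)] [∀ p, CompleteSpace (K p)]
    [∀ p, TopologicalSpace.SeparableSpace (K p)]
    (T : NuclearTriple N H K) (β : ℝ) (hβ0 : 0 < β) (hβ1 : β ≤ 1)
    (η : H) (hη : η ≠ 0) (M : ℝ) (hM : 0 < M) :
    ∃ C : ℝ, ∀ φ : Complexified N, (Complexified.map T.toH φ).hnorm < M →
      Integrable (fun x : ℝ => ‖mittagLeffler β (-donskerArg x η (Complexified.map T.toH φ))‖) ∧
      ∫ x : ℝ, ‖mittagLeffler β (-donskerArg x η (Complexified.map T.toH φ))‖ ≤ C := by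
  obtain ⟨C, hC⟩ := mainTheorem11_general hβ0 hβ1 hη M
  exact ⟨C, fun φ hφ => hC _ hφ.le⟩
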